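/- Let $(S,\mathcal S,Q)$ be a probability space and let $h:S\times\mathbb R\to\mathbb R$ be such that $h(\cdot,t)$ is measurable for every $t\in\mathbb R$ and $h(x,\cdot)$ is convex for every $x\in S$. Let $D^+h(x,t)$ and $D^-h(x,t)$ denote the right and left derivatives of $h(x,\cdot)$ at $t$, and suppose that $\int_S|D^{\pm}h(x,t)|\,Q(dx)<\infty$ for all $t\in\mathbb R$. Fix $t_0\in\mathbb R$ and put $$M(t)=\int_S \big(h(x,t)-h(x,t_0)\big)\,Q(dx),\qquad t\in\mathbb R .$$ Let $X_1,X_2,\ldots$ be i.i.d. $S$-valued random variables with distribution $Q$ on a probability space $(\Omega,\mathcal A,\mathbb P)$. For $n\ge 1$ let $\hat m_n$ be the smallest minimizing point of $$M_n(t)=\frac1n\sum_{i=1}^n\big(h(X_i,t)-h(X_i,t_0)\big),\qquad t\in\mathbb R$$ (with the convention $\hat m_n=0$ at those sample points where $M_n$ has no smallest minimizing point). Suppose that $m\in\mathbb R$ is the unique minimizer of $M$ and that there are $s>2$ and $x_0>0$ such that $$\mathbb E\big[|D^+h(X_1,m+x)|^s\big]<\infty\qquad\text{for all } x\in[-x_0,x_0].$$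 Then every $\hat m_n$, $n\ge1$, is measurable, and $\hat m_n\to m$ $\mathbb P$-$r$-quickly for all $r\in(0,s/2)$; that is, for every $r\in(0,s/2)$ and every $\epsilon>0$, $$\mathbb E[L_\epsilon^r]<\infty,\qquad L_\epsilon:=\sup\{k\ge 1: |\hat m_k-m|>\epsilon\}\in\{0,1,2,\ldots\}\cup\{\infty\},$$ where $\sup\emptyset:=0$. -/

import Mathlib

open MeasureTheory ProbabilityTheory Set
open scoped ENNReal

noncomputable section

namespace ConvexMEst

/-- The right derivative `D⁺f(t)`. -/
def rightDeriv (f : ℝ → ℝ) (t : ℝ) : ℝ := derivWithin f (Ioi t) t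

/-- The left derivative `D⁻f(t)`. -/
def leftDeriv (f : ℝ → ℝ) (t : ℝ) : ℝ := derivWithin f (Iio t) t

/-- The set of all minimizing points of `f`. -/
def argminSet (f : ℝ → ℝ) : Set ℝ := {t | ∀ u, f t ≤ f u}

/-- The smallest minimizing point of `f`. If the set of minimizing points is empty or unbounded
below (so that there is no smallest one), the value is `0` by convention. -/
def smallestMinimizer (f : ℝ → ℝ) : ℝ := sInf (argminSet f)

theorem smallestMinimizer_eq {f : ℝ → ℝ} {t : ℝ} (ht : IsLeast (argminSet f) t) :
    smallestMinimizer f = t :=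
  ht.csInf_eq

/-- The criterion function `M(t) = ∫ (h(x,t) - h(x,t₀)) Q(dx)`. -/
def criterion {S : Type*} [MeasurableSpace S] (Q : Measure S) (h : S → ℝ → ℝ) (t₀ t : ℝ) : ℝ :=
  ∫ x, (h x t - h x t₀) ∂Q

/-- The empirical criterion function
`Mₙ(t) = (1/n) ∑ (h(Xᵢ,t) - h(Xᵢ,t₀))`, the sum being over the first `n` observations
`X 0, …, X (n-1)`. -/
def empCriterion {S Ω : Type*} (h : S → ℝ → ℝ) (t₀ : ℝ) (X : ℕ → Ω → S) (n : ℕ) (ω : Ω)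
    (t : ℝ) : ℝ :=
  (1 / (n : ℝ)) * ∑ i ∈ Finset.range n, (h (X i ω) t - h (X i ω) t₀)

/-- The convex M-estimator: the smallest minimizing point of the empirical criterion function. -/
def mEstimator {S Ω : Type*} (h : S → ℝ → ℝ) (t₀ : ℝ) (X : ℕ → Ω → S) (n : ℕ) (ω : Ω) : ℝ :=
  smallestMinimizer (empCriterion h t₀ X n ω)

/-- The last index `k ≥ 1` with `|Z k - Z∞| > ε`; it is `0` if there is no such index and `∞` if
there are infinitely many of them. -/
def lastExit {Ω : Type*} (Z : ℕ → Ω → ℝ) (Zlim : Ω → ℝ) (ε : ℝ) (ω : Ω) : ℝ≥0∞ :=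
  ⨆ k ∈ {k : ℕ | 1 ≤ k ∧ ε < |Z k ω - Zlim ω|}, (k : ℝ≥0∞)

/-- `r`-quick convergence: the last exit time from every `ε`-tube around the limit has a finite
`r`-th moment. -/
def QuickConverges {Ω : Type*} [MeasurableSpace Ω] (P : Measure Ω) (r : ℝ)
    (Z : ℕ → Ω → ℝ) (Zlim : Ω → ℝ) : Prop :=
  ∀ ε : ℝ, 0 < ε → ∫⁻ ω, lastExit Z Zlim ε ω ^ r ∂P < ∞

end ConvexMEst

end

/-! By convexity, the estimator at time `k` lies in `[m - δ, m + δ]` once the sum of the right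
derivatives of `h (X i)` over `i < k` is negative at `m - δ` and positive at `m + δ`. The integrated
subgradient inequality and the uniqueness of `m` give these derivatives means of the same signs. An
exit at time `k` thus forces one of two random walks with negative drift to be nonnegative at time
`k`.

For such a walk (`exists_lintegral_lt_top_of_integral_neg`), cap the steps from above at `k ^ α`
with `α < 1`. Either the capped walk is nonnegative, which a Chernoff bound makes
stretched-exponentially unlikely, or some step exceeds `k ^ α`, which the `s`-th moment pays for.
This works when `1 + r < s`, which follows from `r < s / 2` and `2 < s`. -/

namespace ConvexMEst

/-! ### Minimizers of a convex function through the sign of its right derivative. -/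

section Convex

variable {f : ℝ → ℝ}

theorem add_rightDeriv_mul_le (hf : ConvexOn ℝ univ f) (a t : ℝ) :
    f a + rightDeriv f a * (t - a) ≤ f t := by
  rcases lt_trichotomy a t with h | rfl | h
  · have := hf.rightDeriv_le_slope_of_mem_interior (x := a) (y := t) (by simp) (mem_univ _) h
    rw [slope_def_field, le_div_iff₀ (by linarith)] at this
    unfold rightDeriv
    linarith
  · simp
  · have h1 := hf.slope_le_leftDeriv_of_mem_interior (x := t) (y := a) (mem_univ _) (by simp) h
    have h2 := h1.trans (hf.leftDeriv_le_rightDeriv_of_mem_interior (by simp))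
    rw [slope_def_field, div_le_iff₀ (by linarith)] at h2
    unfold rightDeriv
    linarith

theorem hasDerivWithinAt_rightDeriv (hf : ConvexOn ℝ univ f) (t : ℝ) :
    HasDerivWithinAt f (rightDeriv f t) (Ioi t) t :=
  hf.hasDerivWithinAt_rightDeriv_of_mem_interior (by simp)

theorem monotone_rightDeriv (hf : ConvexOn ℝ univ f) : Monotone (rightDeriv f) :=
  fun _ _ hxy => hf.monotoneOn_rightDeriv (by simp) (by simp) hxy

theorem isUpperSet_rightDeriv_nonneg (hf : ConvexOn ℝ univ f) :
    IsUpperSet {t | 0 ≤ rightDeriv f t} :=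
  fun _ _ hxy hx => le_trans hx (monotone_rightDeriv hf hxy)

theorem le_of_rightDeriv_nonneg (hf : ConvexOn ℝ univ f) {t u : ℝ} (ht : 0 ≤ rightDeriv f t)
    (htu : t ≤ u) : f t ≤ f u := by
  have := add_rightDeriv_mul_le hf t u
  nlinarith [mul_nonneg ht (sub_nonneg.2 htu)]

theorem le_of_rightDeriv_nonpos (hf : ConvexOn ℝ univ f) {t u : ℝ} (ht : rightDeriv f t ≤ 0)
    (hut : u ≤ t) : f t ≤ f u := by
  have := add_rightDeriv_mul_le hf t u
  nlinarith [mul_nonneg_of_nonpos_of_nonpos ht (sub_nonpos.2 hut)]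

theorem rightDeriv_nonneg_of_mem_argminSet (hf : ConvexOn ℝ univ f) {t : ℝ}
    (ht : t ∈ argminSet f) : 0 ≤ rightDeriv f t := by
  refine ge_of_tendsto ((hasDerivWithinAt_iff_tendsto_slope' self_notMem_Ioi).1
    (hasDerivWithinAt_rightDeriv hf t)) ?_
  filter_upwards [self_mem_nhdsWithin] with u hu
  rw [slope_def_field]
  exact div_nonneg (sub_nonneg.2 (ht u)) (sub_nonneg.2 (le_of_lt hu))

/-- The right derivative is negative left of the infimum and nonnegative right of it; continuity
carries the resulting inequalities to the infimum itself. -/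
theorem sInf_mem_argminSet (hf : ConvexOn ℝ univ f)
    (hne : {t | 0 ≤ rightDeriv f t}.Nonempty) (hbdd : BddBelow {t | 0 ≤ rightDeriv f t}) :
    sInf {t | 0 ≤ rightDeriv f t} ∈ argminSet f := by
  set A := {t | 0 ≤ rightDeriv f t}
  have hcont : Continuous f := by
    simpa [← continuousOn_univ] using hf.continuousOn isOpen_univ
  intro u
  rcases le_or_gt u (sInf A) with hu | hu
  · rcases hu.eq_or_lt with rfl | hu
    · rfl
    refine le_of_tendsto (hcont.continuousAt.continuousWithinAt (s := Iio (sInf A))) ?_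
    filter_upwards [Ioo_mem_nhdsLT hu] with w hw
    have hwA : w ∉ A := fun h => (csInf_le hbdd h).not_gt hw.2
    exact le_of_rightDeriv_nonpos hf (not_le.1 hwA).le hw.1.le
  · refine le_of_tendsto (hcont.continuousAt.continuousWithinAt (s := Ioi (sInf A))) ?_
    filter_upwards [Ioo_mem_nhdsGT hu] with w hw
    obtain ⟨a, haA, haw⟩ := exists_lt_of_csInf_lt hne hw.1
    exact le_of_rightDeriv_nonneg hf (isUpperSet_rightDeriv_nonneg hf haw.le haA) hw.2.le

/-- This replaces the argmin by an upper set with pointwise measurable membership. The degenerate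
cases agree as well: if the upper set is empty, so is the argmin; if it is unbounded below, `f` is
monotone and the argmin is empty or unbounded below. Both infima are then `0`. -/
theorem smallestMinimizer_eq_sInf (hf : ConvexOn ℝ univ f) :
    smallestMinimizer f = sInf {t | 0 ≤ rightDeriv f t} := by
  set A := {t | 0 ≤ rightDeriv f t} with hA
  have hsub : argminSet f ⊆ A := fun t ht => rightDeriv_nonneg_of_mem_argminSet hf ht
  rcases A.eq_empty_or_nonempty with h0 | hne
  · rw [h0] at hsub ⊢
    rw [smallestMinimizer, subset_empty_iff.1 hsub]
  by_cases hbdd : BddBelow A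
  · exact smallestMinimizer_eq
      ⟨sInf_mem_argminSet hf hne hbdd, fun t ht => csInf_le hbdd (hsub ht)⟩
  · rw [Real.sInf_of_not_bddBelow hbdd]
    have hall : ∀ t, t ∈ A := fun t => by
      obtain ⟨a, ha, hat⟩ := not_bddBelow_iff.1 hbdd t
      exact isUpperSet_rightDeriv_nonneg hf hat.le ha
    rcases (argminSet f).eq_empty_or_nonempty with h0 | ⟨t, ht⟩
    · rw [smallestMinimizer, h0, Real.sInf_empty]
    · refine Real.sInf_of_not_bddBelow (not_bddBelow_iff.2 fun x => ?_)
      refine ⟨min t (x - 1), fun u => ?_, by simp⟩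
      exact (le_of_rightDeriv_nonneg hf (hall _) (min_le_left _ _)).trans (ht u)

theorem smallestMinimizer_mem_Icc (hf : ConvexOn ℝ univ f) {a b : ℝ}
    (ha : rightDeriv f a < 0) (hb : 0 < rightDeriv f b) :
    smallestMinimizer f ∈ Icc a b := by
  rw [smallestMinimizer_eq_sInf hf]
  have hlow : a ∈ lowerBounds {t | 0 ≤ rightDeriv f t} := fun t ht => by
    by_contra! hta
    exact absurd (monotone_rightDeriv hf hta.le) (not_le.2 (ha.trans_le ht))
  exact ⟨le_csInf ⟨b, hb.le⟩ hlow, csInf_le ⟨a, hlow⟩ hb.le⟩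

end Convex

/-! ### Measurability of the infimum and of the right derivative. -/

theorem measurable_sInf_of_isUpperSet {Ω : Type*} [MeasurableSpace Ω] {A : Ω → Set ℝ}
    (hA : ∀ ω, IsUpperSet (A ω)) (hmeas : ∀ t, MeasurableSet {ω | t ∈ A ω}) :
    Measurable fun ω => sInf (A ω) := by
  have hne : MeasurableSet {ω | (A ω).Nonempty} := by
    have : {ω | (A ω).Nonempty} = ⋃ n : ℕ, {ω | (n : ℝ) ∈ A ω} := by
      ext ω
      simp only [mem_ofPred_eq, mem_iUnion]
      refine ⟨fun ⟨t, ht⟩ => ?_, fun ⟨n, hn⟩ => ⟨n, hn⟩⟩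
      obtain ⟨n, hn⟩ := exists_nat_ge t
      exact ⟨n, hA ω hn ht⟩
    rw [this]
    exact .iUnion fun n => hmeas n
  have hbdd : MeasurableSet {ω | BddBelow (A ω)} := by
    have : {ω | BddBelow (A ω)} = ⋃ n : ℕ, {ω | -(n : ℝ) ∈ A ω}ᶜ := by
      ext ω
      simp only [mem_ofPred_eq, mem_iUnion, mem_compl_iff]
      refine ⟨fun ⟨t, ht⟩ => ?_, fun ⟨n, hn⟩ => ⟨-n, fun u hu => ?_⟩⟩
      · obtain ⟨n, hn⟩ := exists_nat_gt (-t)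
        exact ⟨n, fun h => by linarith [ht h]⟩
      · by_contra! hun
        exact hn (hA ω hun.le hu)
    rw [this]
    exact .iUnion fun n => (hmeas _).compl
  have hrat (c : ℝ) : MeasurableSet (⋃ q : ℚ, {ω | (q : ℝ) < c ∧ (q : ℝ) ∈ A ω}) :=
    .iUnion fun q => (MeasurableSet.const _).inter (hmeas q)
  refine measurable_of_Iio fun c => ?_
  -- The last piece accounts for the default value `0` of `sInf` on empty or unbounded sets.
  have : (fun ω => sInf (A ω)) ⁻¹' Iio c =
      ({ω | (A ω).Nonempty} ∩ {ω | BddBelow (A ω)} ∩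
        ⋃ q : ℚ, {ω | (q : ℝ) < c ∧ (q : ℝ) ∈ A ω}) ∪
      (({ω | (A ω).Nonempty} ∩ {ω | BddBelow (A ω)})ᶜ ∩ {_ω | 0 < c}) := by
    ext ω
    by_cases h : (A ω).Nonempty ∧ BddBelow (A ω)
    · simp only [mem_preimage, mem_Iio, mem_union, mem_inter_iff, mem_ofPred_eq, mem_iUnion,
        mem_compl_iff, h, not_true, false_and, or_false, true_and, and_self]
      rw [csInf_lt_iff h.2 h.1]
      refine ⟨fun ⟨t, ht, htc⟩ => ?_, fun ⟨q, hq, hqA⟩ => ⟨q, hqA, hq⟩⟩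
      obtain ⟨q, hq1, hq2⟩ := exists_rat_btwn htc
      exact ⟨q, hq2, hA ω hq1.le ht⟩
    · have h0 : sInf (A ω) = 0 := by
        by_cases hn : (A ω).Nonempty
        · exact Real.sInf_of_not_bddBelow fun hb => h ⟨hn, hb⟩
        · rw [not_nonempty_iff_eq_empty.1 hn, Real.sInf_empty]
      simp only [mem_preimage, mem_Iio, mem_union, mem_inter_iff, mem_ofPred_eq, mem_iUnion,
        mem_compl_iff, h, not_false_iff, false_and, false_or, true_and, h0]
  rw [this]
  exact ((hne.inter hbdd).inter (hrat c)).union ((hne.inter hbdd).compl.inter (.const _))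

theorem measurable_rightDeriv {S : Type*} [MeasurableSpace S] {h : S → ℝ → ℝ}
    (hmeas : ∀ t, Measurable fun x => h x t) (hconv : ∀ x, ConvexOn ℝ univ (h x)) (t : ℝ) :
    Measurable fun x => rightDeriv (h x) t := by
  have hu : Filter.Tendsto (fun n : ℕ => t + 1 / ((n : ℝ) + 1)) Filter.atTop
      (nhdsWithin t (Ioi t)) := by
    refine tendsto_nhdsWithin_iff.2 ⟨?_, .of_forall fun n => ?_⟩
    · simpa using tendsto_const_nhds.add (tendsto_one_div_add_atTop_nhds_zero_nat (𝕜 := ℝ))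
    · simp only [mem_Ioi]
      linarith [Nat.one_div_pos_of_nat (α := ℝ) (n := n)]
  refine measurable_of_tendsto_metrizable (f := fun (n : ℕ) x =>
    slope (h x) t (t + 1 / ((n : ℝ) + 1))) (fun n => ?_) (tendsto_pi_nhds.2 fun x => ?_)
  · simp only [slope_def_field]
    exact ((hmeas _).sub (hmeas _)).div_const _
  · exact ((hasDerivWithinAt_iff_tendsto_slope' self_notMem_Ioi).1
      (hasDerivWithinAt_rightDeriv (hconv x) t)).comp hu

/-! ### Exponential estimates and Chernoff bounds for capped random walks. -/

/-- No lower bound on `u` is needed, which is why the steps are capped only from above. -/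
theorem exp_le_one_add_add_sq {u : ℝ} (hu : u ≤ 1) : Real.exp u ≤ 1 + u + u ^ 2 := by
  rcases le_or_gt (-1) u with h | h
  · linarith [(abs_le.1 (Real.abs_exp_sub_one_sub_id_le (abs_le.2 ⟨h, hu⟩))).2]
  · nlinarith [Real.exp_le_one_iff.2 (by linarith : u ≤ 0)]

theorem summable_rpow_mul_exp_neg_rpow (r : ℝ) {c β : ℝ} (hc : 0 < c) (hβ : 0 < β) :
    Summable fun k : ℕ => (k : ℝ) ^ r * Real.exp (-c * (k : ℝ) ^ β) := by
  -- The exponent is chosen so that the product with `k ^ r` is `O(k ^ (-2))`.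
  have h1 : (fun k : ℕ => Real.exp (-c * (k : ℝ) ^ β)) =O[Filter.atTop]
      fun k : ℕ => ((k : ℝ) ^ β) ^ (-(r + 2) / β) :=
    ((isLittleO_exp_neg_mul_rpow_atTop hc (-(r + 2) / β)).comp_tendsto
      ((tendsto_rpow_atTop hβ).comp tendsto_natCast_atTop_atTop)).isBigO
  refine summable_of_isBigO_nat (Real.summable_nat_rpow.2 (by norm_num : (-2 : ℝ) < -1))
    (((Asymptotics.isBigO_refl (fun k : ℕ => (k : ℝ) ^ r) _).mul h1).trans_eventuallyEq ?_)
  filter_upwards [Filter.eventually_gt_atTop 0] with k hk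
  have hk' : (0 : ℝ) < k := by exact_mod_cast hk
  rw [← Real.rpow_mul hk'.le, ← Real.rpow_add hk', mul_div_cancel₀ _ hβ.ne']
  congr 1
  ring

section RandomWalk

variable {Ω : Type*} [MeasurableSpace Ω] {P : Measure Ω} [IsProbabilityMeasure P]

theorem integrable_exp_mul_min {W : Ω → ℝ} (hW : Measurable W) {lam : ℝ} (b : ℝ)
    (hlam : 0 ≤ lam) : Integrable (fun ω => Real.exp (lam * min (W ω) b)) P := by
  refine Integrable.of_bound (by fun_prop) (Real.exp (lam * b)) (.of_forall fun ω => ?_)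
  rw [Real.norm_eq_abs, Real.abs_exp]
  gcongr
  exact min_le_right _ _

/-- Capping from above at `b ≥ 0` lowers both `W` and `W ^ 2`, so the uncapped moments can be used
and the negative drift is kept. -/
theorem mgf_min_le {W : Ω → ℝ} (hW : Measurable W) (hint : Integrable W P)
    (hint2 : Integrable (fun ω => W ω ^ 2) P) {b lam : ℝ} (hb : 0 ≤ b) (hlam : 0 ≤ lam)
    (hlb : lam * b ≤ 1) :
    mgf (fun ω => min (W ω) b) P lam ≤ 1 + lam * ∫ ω, W ω ∂P + lam ^ 2 * ∫ ω, W ω ^ 2 ∂P := by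
  have hi : Integrable (fun ω => 1 + lam * W ω) P := (integrable_const 1).add (hint.const_mul lam)
  have hi2 : Integrable (fun ω => lam ^ 2 * W ω ^ 2) P := hint2.const_mul _
  have : ∫ ω, (1 + lam * W ω + lam ^ 2 * W ω ^ 2) ∂P
      = 1 + lam * ∫ ω, W ω ∂P + lam ^ 2 * ∫ ω, W ω ^ 2 ∂P := by
    rw [integral_add hi hi2, integral_add (integrable_const 1) (hint.const_mul lam),
      integral_const_mul, integral_const_mul]
    simp
  rw [← this]
  refine integral_mono (integrable_exp_mul_min hW b hlam) (hi.add hi2) fun ω => ?_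
  have h1 : lam * min (W ω) b ≤ 1 :=
    (mul_le_mul_of_nonneg_left (min_le_right _ _) hlam).trans hlb
  have h2 : lam * min (W ω) b ≤ lam * W ω := mul_le_mul_of_nonneg_left (min_le_left _ _) hlam
  have h3 : min (W ω) b ^ 2 ≤ W ω ^ 2 := by
    rcases le_total (W ω) b with h | h
    · rw [min_eq_left h]
    · rw [min_eq_right h]
      gcongr
  have h4 := mul_le_mul_of_nonneg_left h3 (sq_nonneg lam)
  have h5 := exp_le_one_add_add_sq h1
  rw [mul_pow] at h5
  simp only
  linarith

theorem measure_sum_min_nonneg_le {Y : ℕ → Ω → ℝ} (hY : ∀ i, Measurable (Y i))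
    (hindep : iIndepFun Y P) (hident : ∀ i, IdentDistrib (Y i) (Y 0) P P)
    (hint : Integrable (Y 0) P) (hint2 : Integrable (fun ω => Y 0 ω ^ 2) P)
    {b lam : ℝ} (hb : 0 ≤ b) (hlam : 0 ≤ lam) (hlb : lam * b ≤ 1) (k : ℕ) :
    P.real {ω | 0 ≤ ∑ i ∈ Finset.range k, min (Y i ω) b} ≤
      Real.exp (k * (lam * ∫ ω, Y 0 ω ∂P + lam ^ 2 * ∫ ω, Y 0 ω ^ 2 ∂P)) := by
  set Z : ℕ → Ω → ℝ := fun i ω => min (Y i ω) b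
  have hZ : ∀ i, Measurable (Z i) := fun i => (hY i).min measurable_const
  have hZindep : iIndepFun Z P :=
    hindep.comp (fun _ y => min y b) fun _ => measurable_id.min measurable_const
  have hmgf (i : ℕ) : mgf (Z i) P lam = mgf (Z 0) P lam :=
    mgf_congr_of_identDistrib _ _
      ((hident i).comp (u := fun y => min y b) (measurable_id.min measurable_const)) lam
  have hexp := hZindep.integrable_exp_mul_sum hZ (s := Finset.range k) (t := lam)
    fun i _ => integrable_exp_mul_min (hY i) b hlam
  have hcher := measure_ge_le_exp_mul_mgf 0 hlam hexp
  simp only [Finset.sum_apply, mul_zero, Real.exp_zero, one_mul] at hcher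
  refine hcher.trans ?_
  rw [hZindep.mgf_sum hZ, Finset.prod_congr rfl fun i _ => hmgf i, Finset.prod_const,
    Finset.card_range, Real.exp_nat_mul]
  refine pow_le_pow_left₀ mgf_nonneg ?_ k
  refine (mgf_min_le (hY 0) hint hint2 hb hlam hlb).trans ?_
  linarith [Real.add_one_le_exp (lam * ∫ ω, Y 0 ω ∂P + lam ^ 2 * ∫ ω, Y 0 ω ^ 2 ∂P)]

theorem exists_measure_sum_min_nonneg_le {Y : ℕ → Ω → ℝ} (hY : ∀ i, Measurable (Y i))
    (hindep : iIndepFun Y P) (hident : ∀ i, IdentDistrib (Y i) (Y 0) P P)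
    (hint : Integrable (Y 0) P) (hint2 : Integrable (fun ω => Y 0 ω ^ 2) P)
    (hneg : ∫ ω, Y 0 ω ∂P < 0) {α : ℝ} (hα : 0 ≤ α) :
    ∃ c : ℝ, 0 < c ∧ ∀ k : ℕ, 1 ≤ k →
      P.real {ω | 0 ≤ ∑ i ∈ Finset.range k, min (Y i ω) ((k : ℝ) ^ α)} ≤
        Real.exp (-c * (k : ℝ) ^ (1 - α)) := by
  set μ := ∫ ω, Y 0 ω ∂P
  set V := ∫ ω, Y 0 ω ^ 2 ∂P
  have hV : 0 ≤ V := integral_nonneg fun ω => sq_nonneg _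
  -- The Chernoff parameter will be `l * k ^ (-α)`: `l ≤ 1` keeps its product with the cap at most
  -- `1`, and the other bound lets the quadratic term use at most half of the drift.
  set l := min 1 (-μ / (2 * (V + 1)))
  have hl : 0 < l := lt_min one_pos (div_pos (by linarith) (by linarith))
  have hlV : l * V ≤ -μ / 2 := by
    have : l * (2 * (V + 1)) ≤ -μ := (le_div_iff₀ (by linarith)).1 (min_le_right _ _)
    nlinarith
  refine ⟨l * (-μ / 2), mul_pos hl (by linarith), fun k hk => ?_⟩
  have hk0 : (0 : ℝ) < k := by exact_mod_cast hk
  have hk1 : (1 : ℝ) ≤ (k : ℝ) := by exact_mod_cast hk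
  have hkα := Real.rpow_pos_of_pos hk0 α
  have hkα1 : 1 ≤ (k : ℝ) ^ α := Real.one_le_rpow hk1 hα
  refine (measure_sum_min_nonneg_le hY hindep hident hint hint2 hkα.le
    (lam := l * ((k : ℝ) ^ α)⁻¹) (by positivity) ?_ k).trans ?_
  · rw [inv_mul_cancel_right₀ hkα.ne']
    exact min_le_left _ _
  · rw [Real.exp_le_exp, Real.rpow_sub hk0, Real.rpow_one]
    have h1 : l * ((k : ℝ) ^ α)⁻¹ * V ≤ -μ / 2 := by
      refine le_trans ?_ hlV
      gcongr
      exact mul_le_of_le_one_right hl.le (inv_le_one_of_one_le₀ hkα1)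
    have h2 : l * ((k : ℝ) ^ α)⁻¹ * μ + (l * ((k : ℝ) ^ α)⁻¹) ^ 2 * V
        ≤ (l * ((k : ℝ) ^ α)⁻¹) * (μ / 2) := by
      have : 0 ≤ l * ((k : ℝ) ^ α)⁻¹ := by positivity
      nlinarith
    calc _ ≤ (k : ℝ) * ((l * ((k : ℝ) ^ α)⁻¹) * (μ / 2)) := by gcongr
      _ = _ := by ring

end RandomWalk

/-! ### Moments of the last time a walk with negative drift is nonnegative. -/

/-- `T` is an integrable pathwise majorant of the `r`-th power of the last nonnegative time. It adds
two series, one over the times at which the capped walk is nonnegative and one over all single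
steps. -/
theorem exists_lintegral_lt_top_of_integral_neg {Ω : Type*} [MeasurableSpace Ω] {P : Measure Ω}
    [IsProbabilityMeasure P] {Y : ℕ → Ω → ℝ} (hY : ∀ i, Measurable (Y i))
    (hindep : iIndepFun Y P) (hident : ∀ i, IdentDistrib (Y i) (Y 0) P P)
    (hint : Integrable (Y 0) P) (hneg : ∫ ω, Y 0 ω ∂P < 0) {r s : ℝ} (hr : 0 < r)
    (hs : 2 ≤ s) (hrs : 1 + r < s) (hmom : Integrable (fun ω => |Y 0 ω| ^ s) P) :
    ∃ T : Ω → ℝ≥0∞, Measurable T ∧ ∫⁻ ω, T ω ∂P < ∞ ∧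
      ∀ ω, ∀ k : ℕ, 1 ≤ k → 0 ≤ ∑ i ∈ Finset.range k, Y i ω → (k : ℝ≥0∞) ^ r ≤ T ω := by
  have hint2 : Integrable (fun ω => Y 0 ω ^ 2) P := by
    refine ((integrable_const (1 : ℝ)).add hmom).mono' (by fun_prop) (.of_forall fun ω => ?_)
    simp only [Real.norm_eq_abs, abs_pow, Pi.add_apply]
    rcases le_total |Y 0 ω| 1 with h | h
    · linarith [pow_le_one₀ (n := 2) (abs_nonneg (Y 0 ω)) h,
        Real.rpow_nonneg (abs_nonneg (Y 0 ω)) s]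
    · have := Real.rpow_le_rpow_of_exponent_le h hs
      rw [Real.rpow_two] at this
      linarith
  -- `(1 + r) / s < α` makes `(i + 1) ^ (r - α * s)` summable; `α < 1` makes the Chernoff bound
  -- decay.
  obtain ⟨α, hα1, hα2⟩ := exists_between ((div_lt_one (by linarith)).2 hrs)
  have hα0 : 0 ≤ α := (div_pos (by linarith) (by linarith)).le.trans hα1.le
  rw [div_lt_iff₀ (by linarith)] at hα1
  obtain ⟨c, hc, hprob⟩ :=
    exists_measure_sum_min_nonneg_le hY hindep hident hint hint2 hneg hα0
  set B : ℕ → Set Ω := fun k => {ω | 0 ≤ ∑ i ∈ Finset.range k, min (Y i ω) ((k : ℝ) ^ α)}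
  have hB (k : ℕ) : MeasurableSet (B k) :=
    measurableSet_le measurable_const
      (Finset.measurable_sum _ fun i _ => (hY i).min measurable_const)
  have hm1 (k : ℕ) : Measurable ((B k).indicator fun _ => ENNReal.ofReal ((k : ℝ) ^ r)) :=
    measurable_const.indicator (hB k)
  have hm2 (i : ℕ) : Measurable fun ω =>
      ENNReal.ofReal (|Y i ω| ^ s) * ENNReal.ofReal (((i : ℝ) + 1) ^ (r - α * s)) := by
    have := hY i
    fun_prop
  refine ⟨fun ω => ∑' k, (B k).indicator (fun _ => ENNReal.ofReal ((k : ℝ) ^ r)) ω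
    + ∑' i : ℕ, ENNReal.ofReal (|Y i ω| ^ s) * ENNReal.ofReal (((i : ℝ) + 1) ^ (r - α * s)),
    (Measurable.tsum hm1).add (Measurable.tsum hm2), ?_, fun ω k hk hsum => ?_⟩
  · rw [lintegral_add_left (Measurable.tsum hm1),
      lintegral_tsum fun k => (hm1 k).aemeasurable, lintegral_tsum fun i => (hm2 i).aemeasurable]
    refine ENNReal.add_lt_top.2 ⟨?_, ?_⟩
    · have hsummable := summable_rpow_mul_exp_neg_rpow r hc (sub_pos.2 hα2)
      refine lt_of_le_of_lt (ENNReal.tsum_le_tsum fun k => ?_)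
        hsummable.tsum_ofReal_lt_top
      rw [lintegral_indicator_const (hB k)]
      rcases k.eq_zero_or_pos with rfl | hk
      · simp [Real.zero_rpow hr.ne']
      · rw [ENNReal.ofReal_mul (by positivity), ← ofReal_measureReal]
        gcongr
        exact hprob k hk
    · have hlint (i : ℕ) : ∫⁻ ω, ENNReal.ofReal (|Y i ω| ^ s) ∂P
          = ENNReal.ofReal (∫ ω, |Y 0 ω| ^ s ∂P) := by
        rw [ofReal_integral_eq_lintegral_ofReal hmom (.of_forall fun ω => by positivity)]
        exact ((hident i).comp (u := fun y => ENNReal.ofReal (|y| ^ s)) (by fun_prop)).lintegral_eq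
      have hsummable : Summable fun i : ℕ => ((i : ℝ) + 1) ^ (r - α * s) := by
        have := (summable_nat_add_iff 1).2
          (Real.summable_nat_rpow.2 (by linarith : r - α * s < -1))
        simpa using this
      have hYm (i : ℕ) : Measurable fun ω => ENNReal.ofReal (|Y i ω| ^ s) := by
        have := hY i
        fun_prop
      simp_rw [lintegral_mul_const _ (hYm _), hlint, ENNReal.tsum_mul_left]
      exact ENNReal.mul_lt_top ENNReal.ofReal_lt_top hsummable.tsum_ofReal_lt_top
  · have hk0 : (0 : ℝ) < k := by exact_mod_cast hk
    have hkr : (k : ℝ≥0∞) ^ r = ENNReal.ofReal ((k : ℝ) ^ r) := by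
      rw [← ENNReal.ofReal_rpow_of_nonneg hk0.le hr.le, ENNReal.ofReal_natCast]
    rw [hkr]
    -- A large step at index `i` pays for every later `k`: the negative exponent `r - α * s` allows
    -- `k` to be replaced by `i + 1 ≤ k`, so a single term of the second series suffices. Without a
    -- large step the cap is inactive and the `k`-th term of the first series suffices.
    by_cases hbig : ∃ i ∈ Finset.range k, (k : ℝ) ^ α < Y i ω
    · obtain ⟨i, hik, hi⟩ := hbig
      refine le_trans ?_ (le_add_of_nonneg_left zero_le)
      refine le_trans ?_ (ENNReal.le_tsum i)
      rw [← ENNReal.ofReal_mul (by positivity)]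
      refine ENNReal.ofReal_le_ofReal ?_
      have hik' : (i : ℝ) + 1 ≤ k := by exact_mod_cast Finset.mem_range.1 hik
      calc (k : ℝ) ^ r = ((k : ℝ) ^ α) ^ s * (k : ℝ) ^ (r - α * s) := by
            rw [← Real.rpow_mul hk0.le, ← Real.rpow_add hk0]
            congr 1
            ring
        _ ≤ |Y i ω| ^ s * ((i : ℝ) + 1) ^ (r - α * s) := by
            refine mul_le_mul ?_ ?_ (by positivity) (by positivity)
            · exact Real.rpow_le_rpow (by positivity) (hi.le.trans (le_abs_self _)) (by linarith)
            · exact Real.rpow_le_rpow_of_nonpos (by positivity) hik' (by linarith)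
    · push Not at hbig
      refine le_trans ?_ (le_add_of_nonneg_right zero_le)
      refine le_trans ?_ (ENNReal.le_tsum k)
      rw [indicator_of_mem]
      simpa only [B, mem_ofPred_eq,
        Finset.sum_congr rfl fun i hi => min_eq_left (hbig i hi)] using hsum

/-! ### The empirical criterion and the estimator. -/

section Estimator

variable {S Ω : Type*} {h : S → ℝ → ℝ}

theorem convexOn_empCriterion (hconv : ∀ x, ConvexOn ℝ univ (h x)) (t₀ : ℝ) (X : ℕ → Ω → S)
    (n : ℕ) (ω : Ω) : ConvexOn ℝ univ (empCriterion h t₀ X n ω) := by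
  have hsum : ∀ s : Finset ℕ,
      ConvexOn ℝ univ fun t => ∑ i ∈ s, (h (X i ω) t - h (X i ω) t₀) := fun s => by
    induction s using Finset.cons_induction with
    | empty => simpa using convexOn_const 0 convex_univ
    | cons a s ha ih =>
      simp only [Finset.sum_cons]
      exact ((hconv _).sub (concaveOn_const _ convex_univ)).add ih
  exact (hsum _).smul (by positivity : (0 : ℝ) ≤ 1 / n)

theorem rightDeriv_empCriterion (hconv : ∀ x, ConvexOn ℝ univ (h x)) (t₀ : ℝ) (X : ℕ → Ω → S)
    (n : ℕ) (ω : Ω) (t : ℝ) : rightDeriv (empCriterion h t₀ X n ω) t =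
      (1 / (n : ℝ)) * ∑ i ∈ Finset.range n, rightDeriv (h (X i ω)) t := by
  refine HasDerivWithinAt.derivWithin ?_ (uniqueDiffWithinAt_Ioi t)
  exact (HasDerivWithinAt.fun_sum fun i _ =>
    (hasDerivWithinAt_rightDeriv (hconv (X i ω)) t).sub_const _).const_mul _

theorem measurable_mEstimator [MeasurableSpace S] [MeasurableSpace Ω]
    (hmeas : ∀ t, Measurable fun x => h x t) (hconv : ∀ x, ConvexOn ℝ univ (h x)) (t₀ : ℝ)
    {X : ℕ → Ω → S} (hX : ∀ i, Measurable (X i)) (n : ℕ) :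
    Measurable (mEstimator h t₀ X n) := by
  have heq : mEstimator h t₀ X n =
      fun ω => sInf {t | 0 ≤ rightDeriv (empCriterion h t₀ X n ω) t} :=
    funext fun ω => smallestMinimizer_eq_sInf (convexOn_empCriterion hconv t₀ X n ω)
  rw [heq]
  refine measurable_sInf_of_isUpperSet
    (fun ω => isUpperSet_rightDeriv_nonneg (convexOn_empCriterion hconv t₀ X n ω)) fun t => ?_
  simp only [mem_ofPred_eq, rightDeriv_empCriterion hconv]
  exact measurableSet_le measurable_const (measurable_const.mul
    (Finset.measurable_sum _ fun i _ => (measurable_rightDeriv hmeas hconv t).comp (hX i)))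

theorem mEstimator_mem_Icc (hconv : ∀ x, ConvexOn ℝ univ (h x)) (t₀ : ℝ) {X : ℕ → Ω → S}
    {n : ℕ} (hn : 1 ≤ n) {ω : Ω} {a b : ℝ}
    (ha : ∑ i ∈ Finset.range n, rightDeriv (h (X i ω)) a < 0)
    (hb : 0 < ∑ i ∈ Finset.range n, rightDeriv (h (X i ω)) b) :
    mEstimator h t₀ X n ω ∈ Icc a b := by
  have hn' : (0 : ℝ) < 1 / n := by
    have : (0 : ℝ) < n := by exact_mod_cast hn
    positivity
  refine smallestMinimizer_mem_Icc (convexOn_empCriterion hconv t₀ X n ω) ?_ ?_ <;>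
    rw [rightDeriv_empCriterion hconv]
  · exact mul_neg_of_pos_of_neg hn' ha
  · exact mul_pos hn' hb

end Estimator

/-! ### The limiting criterion. -/

section Criterion

variable {S : Type*} [MeasurableSpace S] {Q : Measure S} {h : S → ℝ → ℝ}

/-- The subgradient inequalities at `t` and at `u` sandwich the difference between integrable
functions. -/
theorem integrable_sub (hmeas : ∀ t, Measurable fun x => h x t)
    (hconv : ∀ x, ConvexOn ℝ univ (h x))
    (hright : ∀ t, Integrable (fun x => rightDeriv (h x) t) Q) (t u : ℝ) :
    Integrable (fun x => h x t - h x u) Q := by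
  refine (((hright u).norm.mul_const |t - u|).add ((hright t).norm.mul_const |t - u|)).mono'
    ((hmeas t).sub (hmeas u)).aestronglyMeasurable (.of_forall fun x => ?_)
  have h1 := add_rightDeriv_mul_le (hconv x) u t
  have h2 := add_rightDeriv_mul_le (hconv x) t u
  have h3 := neg_abs_le (rightDeriv (h x) u * (t - u))
  have h4 := le_abs_self (rightDeriv (h x) t * (t - u))
  simp only [Pi.add_apply, Real.norm_eq_abs, ← abs_mul]
  rw [abs_le]
  constructor <;>
    nlinarith [abs_nonneg (rightDeriv (h x) t * (t - u)),
      abs_nonneg (rightDeriv (h x) u * (t - u))]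

/-- With `u = m`, a strict gap between criterion values fixes the sign of the mean right derivative,
without differentiating under the integral. -/
theorem integral_rightDeriv_mul_le_criterion_sub (hmeas : ∀ t, Measurable fun x => h x t)
    (hconv : ∀ x, ConvexOn ℝ univ (h x))
    (hright : ∀ t, Integrable (fun x => rightDeriv (h x) t) Q) (t₀ t u : ℝ) :
    (∫ x, rightDeriv (h x) t ∂Q) * (u - t) ≤ criterion Q h t₀ u - criterion Q h t₀ t := by
  have hint := integrable_sub hmeas hconv hright
  rw [criterion, criterion, ← integral_sub (hint _ _) (hint _ _), ← integral_mul_const]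
  refine integral_mono ((hright t).mul_const _) ((hint _ _).sub (hint _ _)) fun x => ?_
  have := add_rightDeriv_mul_le (hconv x) t u
  simp only
  linarith

theorem criterion_lt_of_argminSet_eq {f : ℝ → ℝ} {m : ℝ} (hm : argminSet f = {m}) {t : ℝ}
    (ht : t ≠ m) : f m < f t := by
  have hmem : m ∈ argminSet f := hm ▸ mem_singleton m
  refine (hmem t).lt_of_ne fun heq => ht ?_
  have : t ∈ argminSet f := fun u => heq ▸ hmem u
  rwa [hm] at this

end Criterion

/-! ### Last exit times and the conclusion. -/

theorem lastExit_anti {Ω : Type*} (Z : ℕ → Ω → ℝ) (Zlim : Ω → ℝ) {δ ε : ℝ} (hδε : δ ≤ ε)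
    (ω : Ω) : lastExit Z Zlim ε ω ≤ lastExit Z Zlim δ ω :=
  biSup_mono fun _ hk => ⟨hk.1, hδε.trans_lt hk.2⟩

theorem lastExit_rpow_le {Ω : Type*} {Z : ℕ → Ω → ℝ} {Zlim : Ω → ℝ} {ε r : ℝ} (hr : 0 < r)
    {ω : Ω} {T : ℝ≥0∞}
    (hT : ∀ k : ℕ, 1 ≤ k → ε < |Z k ω - Zlim ω| → (k : ℝ≥0∞) ^ r ≤ T) :
    lastExit Z Zlim ε ω ^ r ≤ T := by
  rw [← ENNReal.le_rpow_inv_iff hr]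
  exact iSup₂_le fun k hk => (ENNReal.le_rpow_inv_iff hr).2 (hT k hk.1 hk.2)

end ConvexMEst

open ConvexMEst in
theorem mainTheorem9 {S Ω : Type*} [MeasurableSpace S] [MeasurableSpace Ω]
    (Q : Measure S) [IsProbabilityMeasure Q] (P : Measure Ω) [IsProbabilityMeasure P]
    (h : S → ℝ → ℝ) (t₀ : ℝ)
    (hmeas : ∀ t, Measurable fun x => h x t)
    (hconv : ∀ x, ConvexOn ℝ univ (h x))
    (hright : ∀ t, Integrable (fun x => ConvexMEst.rightDeriv (h x) t) Q)
    (hleft : ∀ t, Integrable (fun x => ConvexMEst.leftDeriv (h x) t) Q)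
    (X : ℕ → Ω → S) (hX : ∀ i, Measurable (X i))
    (hindep : iIndepFun X P) (hlaw : ∀ i, P.map (X i) = Q)
    (m : ℝ) (hm : ConvexMEst.argminSet (ConvexMEst.criterion Q h t₀) = {m})
    (s : ℝ) (hs : 2 < s)
    (hmoment : ∃ x₀ : ℝ, 0 < x₀ ∧ ∀ x ∈ Icc (-x₀) x₀,
      Integrable (fun ω => |ConvexMEst.rightDeriv (h (X 0 ω)) (m + x)| ^ s) P) :
    (∀ n : ℕ, 1 ≤ n → Measurable (ConvexMEst.mEstimator h t₀ X n)) ∧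
    ∀ r : ℝ, 0 < r → r < s / 2 →
      ConvexMEst.QuickConverges P r (ConvexMEst.mEstimator h t₀ X) (fun _ => m) := by
  refine ⟨fun n _ => measurable_mEstimator hmeas hconv t₀ hX n, fun r hr hrs ε hε => ?_⟩
  obtain ⟨x₀, hx₀, hmom⟩ := hmoment
  -- Shrinking the tube only increases the last exit time, and it puts `m ± δ` where the moment
  -- condition holds.
  set δ := min ε x₀
  have hδ : 0 < δ := lt_min hε hx₀
  have hδx : δ ≤ x₀ := min_le_right _ _
  have key (g : S → ℝ) (hg : Measurable g) (hgi : Integrable g Q) (hneg : ∫ x, g x ∂Q < 0)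
      (hgs : Integrable (fun ω => |g (X 0 ω)| ^ s) P) : ∃ T : Ω → ℝ≥0∞, Measurable T ∧ ∫⁻ ω, T ω ∂P < ∞ ∧
      ∀ ω, ∀ k : ℕ, 1 ≤ k → 0 ≤ ∑ i ∈ Finset.range k, g (X i ω) → (k : ℝ≥0∞) ^ r ≤ T ω := by
    rw [← hlaw 0, integral_map (hX 0).aemeasurable hg.aestronglyMeasurable] at hneg
    rw [← hlaw 0] at hgi
    have hident (i : ℕ) : IdentDistrib (X i) (X 0) P P :=
      ⟨(hX i).aemeasurable, (hX 0).aemeasurable, (hlaw i).trans (hlaw 0).symm⟩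
    exact exists_lintegral_lt_top_of_integral_neg (fun i => hg.comp (hX i))
      (hindep.comp (fun _ => g) fun _ => hg) (fun i => (hident i).comp hg)
      (hgi.comp_measurable (hX 0)) hneg hr hs.le (by linarith) hgs
  have hrd := measurable_rightDeriv hmeas hconv
  have hcrit := integral_rightDeriv_mul_le_criterion_sub hmeas hconv hright t₀
  obtain ⟨T₁, hTm₁, hT₁, hT₁'⟩ := key (fun x => rightDeriv (h x) (m + -δ)) (hrd _) (hright _)
    (by
      have h1 := hcrit (m + -δ) m
      have h2 := criterion_lt_of_argminSet_eq hm (t := m + -δ) (by linarith)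
      by_contra! h3
      nlinarith [mul_nonneg h3 hδ.le])
    (hmom _ ⟨by linarith, by linarith⟩)
  obtain ⟨T₂, -, hT₂, hT₂'⟩ := key (fun x => -rightDeriv (h x) (m + δ)) (hrd _).neg (hright _).neg
    (by
      have h1 := hcrit (m + δ) m
      have h2 := criterion_lt_of_argminSet_eq hm (t := m + δ) (by linarith)
      rw [integral_neg]
      by_contra! h3
      nlinarith [mul_nonneg h3 hδ.le])
    (by simpa only [abs_neg] using hmom _ ⟨by linarith, hδx⟩)
  have hbound (ω : Ω) : lastExit (mEstimator h t₀ X) (fun _ => m) ε ω ^ r ≤ T₁ ω + T₂ ω := by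
    refine (ENNReal.rpow_le_rpow (lastExit_anti _ _ (min_le_left ε x₀) ω) hr.le).trans
      (lastExit_rpow_le hr fun k hk hkδ => ?_)
    -- If `k ^ r` exceeds `T₁ ω + T₂ ω`, it exceeds each of them, so both walks are negative at time
    -- `k` and the estimator is trapped in the tube.
    by_contra! hlt
    have hlt₁ := (le_add_of_nonneg_right zero_le).trans_lt hlt
    have hlt₂ := (le_add_of_nonneg_left zero_le).trans_lt hlt
    have ha := not_le.1 fun h0 => hlt₁.not_ge (hT₁' ω k hk h0)
    have hb := not_le.1 fun h0 => hlt₂.not_ge (hT₂' ω k hk h0)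
    rw [Finset.sum_neg_distrib, neg_lt_zero] at hb
    have hmem := mEstimator_mem_Icc hconv t₀ hk ha hb
    exact hkδ.not_ge (abs_le.2 ⟨by linarith [hmem.1], by linarith [hmem.2]⟩)
  refine (lintegral_mono hbound).trans_lt ?_
  rw [lintegral_add_left hTm₁]
  exact ENNReal.add_lt_top.2 ⟨hT₁, hT₂⟩
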